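/- Let $k,n\in\mathbb N$, let $\hat x_1,\dots,\hat x_n\in\mathbb R^k$ be training samples with labels $y_1,\dots,y_n\in\{-1,+1\}$, and let $\rho_l,\rho_d>0$. Write $w\in\mathbb R^{k+1}$ as $w=(\tilde w,b)$ with $\tilde w\in\mathbb R^k$, $b\in\mathbb R$, write $X=(x_1,\dots,x_n)\in(\mathbb R^k)^n$, put $[z]_+=\max(0,z)$, and define the costs of the learner and of the data generator by $$c_l(w,X)=\frac{\rho_l}{2}\|\tilde w\|^2+\sum_{i=1}^n\bigl[1-y_i(\tilde w^\top x_i+b)\bigr]_+,\qquad c_d(w,X)=\frac{\rho_d}{2}\sum_{i=1}^n\|x_i-\hat x_i\|^2+\sum_{i=1}^n\bigl[1+y_i(\tilde w^\top x_i+b)\bigr]_+ .$$ For $\mu\in\mathbb R^m$ and $\sigma\in\mathbb R_+^m=[0,\infty)^m$ let $\mathcal N(\mu,\sigma)$ be the axis-aligned Gaussian distribution on $\mathbb R^m$ with independent coordinates of mean $\mu_j$ and standard deviation $\sigma_j$ (the coordinate is the constant $\mu_j$ if $\sigma_j=0$). Let $B_l\subset\mathbb R^{k+1}\times\mathbb R_+^{k+1}$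 and $B_d\subset\mathbb R^k\times\mathbb R_+^k$ be non-empty, convex, bounded and closed. The strategy sets are $\Theta_l=B_l$ for the learner and $\Theta_d=B_d^{\,n}$ for the data generator. When the profile $(\theta_l,\theta_d)\in\Theta_l\times\Theta_d$ with $\theta_l=(\mu_w,\sigma_w)$ and $\theta_d=((\mu_{x_i},\sigma_{x_i}))_{i=1}^n$ is played, $w\sim\mathcal N(\mu_w,\sigma_w)$ and $x_i\sim\mathcal N(\mu_{x_i},\sigma_{x_i})$ ($1\le i\le n$) are drawn independently, and the players incur the expected costs $$\bar c_l(\theta_l,\theta_d)=\mathbb E[c_l(w,X)],\qquad \bar c_d(\theta_l,\theta_d)=\mathbb E[c_d(w,X)].$$ Then these expectations are finite for every $(\theta_l,\theta_d)\in\Theta_l\times\Theta_d$, and the game has at least one Nash equilibrium: there is $(\theta_l^\star,\theta_d^\star)\in\Theta_l\times\Theta_d$ with $$\bar c_l(\theta_l^\star,\theta_d^\star)\le\bar c_l(\theta_l,\theta_d^\star)\ \text{ for all }\theta_l\in\Theta_l,\qquad \bar c_d(\theta_l^\star,\theta_d^\star)\le\bar c_d(\theta_l^\star,\theta_d)\ \text{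 for all }\theta_d\in\Theta_d .$$ -/

import Mathlib

open MeasureTheory ProbabilityTheory

namespace SVMGame

/-- A pair `(μ, σ)` of a mean vector and a vector of standard deviations in `ℝᵈ`. -/
abbrev Params (d : ℕ) : Type := (Fin d → ℝ) × (Fin d → ℝ)

/-- The set `ℝᵈ × ℝ₊ᵈ` of all parameters of axis-aligned Gaussians. A zero standard deviation is
allowed and gives a degenerate (constant) coordinate. -/
def gaussianParams (d : ℕ) : Set (Params d) := {θ | ∀ j, 0 ≤ θ.2 j}

/-- The axis-aligned Gaussian distribution on `ℝᵈ` with mean `θ.1` and standard deviations `θ.2`,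
that is, covariance matrix `diag (θ.2 j ^ 2)`. -/
noncomputable def axisGaussian {d : ℕ} (θ : Params d) : Measure (Fin d → ℝ) :=
  Measure.pi fun j => gaussianReal (θ.1 j) (Real.toNNReal (θ.2 j ^ 2))

/-- The squared Euclidean norm on `ℝᵈ`. -/
def sqNorm {d : ℕ} (v : Fin d → ℝ) : ℝ := ∑ j, v j ^ 2

/-- The weight part `w̃ ∈ ℝᵏ` of a learner's vector `w = (w̃, b) ∈ ℝᵏ⁺¹`. -/
def weights {k : ℕ} (w : Fin (k + 1) → ℝ) : Fin k → ℝ := fun j => w j.castSucc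

/-- The bias part `b` of a learner's vector `w = (w̃, b) ∈ ℝᵏ⁺¹`. -/
def bias {k : ℕ} (w : Fin (k + 1) → ℝ) : ℝ := w (Fin.last k)

/-- The linear decision function `f(x; w) = w̃ᵀ x + b`. -/
def decision {k : ℕ} (w : Fin (k + 1) → ℝ) (x : Fin k → ℝ) : ℝ :=
  (∑ j, weights w j * x j) + bias w

/-- The learner's loss `[1 - z y]₊` (hinge loss). -/
def learnerLoss (z y : ℝ) : ℝ := max 0 (1 - z * y)

/-- The data generator's loss `[1 + z y]₊` (hinge loss under wrong labelling). -/
def generatorLoss (z y : ℝ) : ℝ := max 0 (1 + z * y)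

/-- The learner's cost `c_l(w, X)`; the bias is not regularized. -/
noncomputable def learnerCost {k n : ℕ} (ρ : ℝ) (y : Fin n → ℝ)
    (w : Fin (k + 1) → ℝ) (X : Fin n → Fin k → ℝ) : ℝ :=
  ρ / 2 * sqNorm (weights w) + ∑ i, learnerLoss (decision w (X i)) (y i)

/-- The data generator's cost `c_d(w, X)`, with original training samples `xhat`. -/
noncomputable def generatorCost {k n : ℕ} (ρ : ℝ) (xhat : Fin n → Fin k → ℝ) (y : Fin n → ℝ)
    (w : Fin (k + 1) → ℝ) (X : Fin n → Fin k → ℝ) : ℝ :=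
  ρ / 2 * (∑ i, sqNorm (X i - xhat i)) + ∑ i, generatorLoss (decision w (X i)) (y i)

/-- The learner's distribution `p_l(·; θ)` on `ℝᵏ⁺¹`. -/
noncomputable def learnerDist {k : ℕ} (θ : Params (k + 1)) : Measure (Fin (k + 1) → ℝ) :=
  axisGaussian θ

/-- The data generator's distribution `p_d(·; θ)` on `n`-tuples of samples in `ℝᵏ`: the samples are
independent, the `i`-th one being an axis-aligned Gaussian with parameters `θ i`. -/
noncomputable def generatorDist {k n : ℕ} (θ : Fin n → Params k) : Measure (Fin n → Fin k → ℝ) :=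
  Measure.pi fun i => axisGaussian (θ i)

/-- The joint law of `(w, X)` under the strategy profile `(θl, θd)`. -/
noncomputable def jointDist {k n : ℕ} (θl : Params (k + 1)) (θd : Fin n → Params k) :
    Measure ((Fin (k + 1) → ℝ) × (Fin n → Fin k → ℝ)) :=
  (learnerDist θl).prod (generatorDist θd)

/-- The expected cost of a strategy profile, for an underlying cost function `c(w, X)`. -/
noncomputable def expectedCost {k n : ℕ} (c : (Fin (k + 1) → ℝ) → (Fin n → Fin k → ℝ) → ℝ)
    (θl : Params (k + 1)) (θd : Fin n → Params k) : ℝ :=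
  ∫ p, c p.1 p.2 ∂(jointDist θl θd)

/-- The expectation of the cost `c(w, X)` under a strategy profile is finite. -/
def HasFiniteExpectedCost {k n : ℕ} (c : (Fin (k + 1) → ℝ) → (Fin n → Fin k → ℝ) → ℝ)
    (θl : Params (k + 1)) (θd : Fin n → Params k) : Prop :=
  Integrable (fun p : (Fin (k + 1) → ℝ) × (Fin n → Fin k → ℝ) => c p.1 p.2) (jointDist θl θd)

/-- The learner's strategy set `Θ_l`. -/
def learnerStrategies {k : ℕ} (Bl : Set (Params (k + 1))) : Set (Params (k + 1)) :=
  gaussianParams (k + 1) ∩ Bl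

/-- The data generator's strategy set `Θ_d`, a product over the `n` samples. -/
def generatorStrategies {k : ℕ} (n : ℕ) (Bd : Set (Params k)) : Set (Fin n → Params k) :=
  Set.univ.pi fun _ => gaussianParams k ∩ Bd

/-- `(a, b)` is a Nash equilibrium of the two-player game with strategy sets `A`, `B` in which the
players minimize the costs `cA`, `cB`. -/
def IsNashEquilibrium {α β : Type*} (A : Set α) (B : Set β) (cA cB : α → β → ℝ)
    (a : α) (b : β) : Prop :=
  a ∈ A ∧ b ∈ B ∧ (∀ a' ∈ A, cA a b ≤ cA a' b) ∧ (∀ b' ∈ B, cB a b ≤ cB a b')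

end SVMGame

/-! A coordinate with mean `μ` and deviation `σ` has the law of `μ + σξ` with `ξ` standard normal.
Hence the samples of every profile come from one fixed noise law through a map that, for fixed
noise, is linear in the strategies (`jointDist_eq_map`, `affineSample_combo`). Each cost is convex
in its own player's variable, so averaging over the noise makes the expected cost convex in that
player's strategy. The costs grow at most quadratically and the noise has second moments:
expectations are finite, and dominated convergence makes them jointly continuous
(`continuous_expectedCost`).

What remains is a continuous game on compact convex sets with costs convex in the own strategy. Its
equilibrium comes from Ky Fan's inequality for the sum of the costs of unilateral deviations
(`exists_isNashEquilibrium`). The topological input is obtained combinatorially: a parity argument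
gives Scarf's lemma (`exists_dominant_rainbow`), finer and finer grids turn it into the dual KKM
theorem (`exists_mem_iInter_of_face_subset`), and this yields Ky Fan's inequality on finitely many
points, then on compact sets. -/

namespace SVMGame

/-! ### Scarf's lemma by a parity count. -/

section Scarf

/-- A finite set `P` is dominant for a family of rankings if no element strictly exceeds, in every
ranking, the minimum of that ranking over `P`. -/
def Dominant {V I : Type*} (r : I → V → ℕ) (P : Finset V) : Prop :=
  ∀ y, ∃ i, ∀ x ∈ P, r i y ≤ r i x

lemma Dominant.mono {V I : Type*} {r : I → V → ℕ} {P Q : Finset V} (h : Dominant r P)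
    (hQ : Q ⊆ P) : Dominant r Q := fun y =>
  let ⟨i, hi⟩ := h y
  ⟨i, fun x hx => hi x (hQ hx)⟩

/-- A map from `I` onto a finite set with one element less identifies exactly one pair. -/
lemma exists_unique_collision {V I : Type*} [Fintype I] [DecidableEq I] [DecidableEq V]
    {Q : Finset V} (hcard : Q.card + 1 = Fintype.card I) (m : I → V) (hm : ∀ i, m i ∈ Q)
    (hsurj : ∀ q ∈ Q, ∃ i, m i = q) :
    ∃ a b, a ≠ b ∧ m a = m b ∧ ∀ j, j = a ∨ j = b ↔ Set.InjOn m {i | i ≠ j} := by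
  obtain ⟨a, -, b, -, hab, heq⟩ := Finset.exists_ne_map_eq_of_card_lt_of_maps_to
    (s := (Finset.univ : Finset I)) (t := Q) (by simp [← hcard]) (f := m) (fun i _ => hm i)
  -- Without `a` the map is still onto `Q`, since `b` takes over its value; the sizes now agree, so
  -- it is injective.
  have key : ∀ a b, a ≠ b → m a = m b → Set.InjOn m {i | i ≠ a} := by
    intro a b hab heq
    have : Set.InjOn m (Finset.univ.erase a : Finset I) := by
      apply Finset.injOn_of_surjOn_of_card_le m (t := Q) (fun i _ => hm i)
      · intro q hq
        obtain ⟨i, rfl⟩ := hsurj q hq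
        by_cases h : i = a
        · exact ⟨b, by simp [hab.symm], by rw [h, heq]⟩
        · exact ⟨i, by simp [h], rfl⟩
      · rw [Finset.card_erase_of_mem (Finset.mem_univ _), Finset.card_univ]; omega
    intro i hi j hj hij
    exact this (by simpa using hi) (by simpa using hj) hij
  refine ⟨a, b, hab, heq, fun j => ⟨?_, fun h => ?_⟩⟩
  · rintro (rfl | rfl)
    · exact key _ b hab heq
    · exact key _ a hab.symm heq.symm
  · by_contra hj
    push Not at hj
    exact hab (h (Ne.symm hj.1) (Ne.symm hj.2) heq)

/-- A dominant set with `|I| - 1` elements extends to a dominant set with `|I|` elements by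
adjoining a maximal element of one of two sets. -/
lemma dominant_insert_iff {V I : Type*} [Fintype I] [DecidableEq I] [DecidableEq V]
    {r : I → V → ℕ} (hr : ∀ i, Function.Injective (r i)) {Q : Finset V}
    (hcard : Q.card + 1 = Fintype.card I) (hdom : Dominant r Q) (m : I → V) (hm : ∀ i, m i ∈ Q)
    (hmin : ∀ i, ∀ x ∈ Q, r i (m i) ≤ r i x) (y : V) :
    (y ∉ Q ∧ Dominant r (insert y Q)) ↔
      ∃ j, Set.InjOn m {i | i ≠ j} ∧ (∀ i, i ≠ j → r i (m i) < r i y) ∧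
        ∀ z, (∀ i, i ≠ j → r i (m i) < r i z) → r j z ≤ r j y := by
  constructor
  · rintro ⟨hy, hd⟩
    have hmin' : ∀ i, ∃ x ∈ insert y Q, ∀ z ∈ insert y Q, r i x ≤ r i z := fun i =>
      Finset.exists_min_image _ (r i) (Finset.insert_nonempty _ _)
    choose m' hm' hm'min using hmin'
    -- Dominance tested at a member `q` of the set makes `q` the minimizer of some ranking. Sizes
    -- agree, so minimizers match members bijectively: `y` serves exactly one index `j`, and all
    -- others keep their minimizer in `Q`.
    have hsurj : ∀ q ∈ insert y Q, ∃ i, m' i = q := by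
      intro q hq
      obtain ⟨i, hi⟩ := hd q
      exact ⟨i, hr i (le_antisymm (hm'min i q hq) (hi _ (hm' i)))⟩
    have hinj : Set.InjOn m' (Finset.univ : Finset I) := by
      apply Finset.injOn_of_surjOn_of_card_le m' (t := insert y Q) (fun i _ => hm' i)
      · intro q hq
        obtain ⟨i, hi⟩ := hsurj q hq
        exact ⟨i, by simp, hi⟩
      · rw [Finset.card_insert_of_notMem hy, hcard, Finset.card_univ]
    obtain ⟨j, hj⟩ := hsurj y (Finset.mem_insert_self _ _)
    have hm'm : ∀ i, i ≠ j → m' i = m i := by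
      intro i hij
      have h1 : m' i ≠ y := fun h => hij (hinj (by simp) (by simp) (h.trans hj.symm))
      have h2 : m' i ∈ Q := (Finset.mem_insert.1 (hm' i)).resolve_left h1
      exact hr i (le_antisymm (hm'min i _ (Finset.mem_insert_of_mem (hm i))) (hmin i _ h2))
    refine ⟨j, ?_, ?_, ?_⟩
    · intro i hi k hk hik
      rw [← hm'm i hi, ← hm'm k hk] at hik
      exact hinj (by simp) (by simp) hik
    · intro i hi
      refine lt_of_le_of_ne ?_ fun h => hy (hr i h ▸ hm i)
      rw [← hm'm i hi]
      exact hm'min i y (Finset.mem_insert_self _ _)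
    · intro z hz
      obtain ⟨i, hi⟩ := hd z
      by_cases hij : i = j
      · subst hij
        exact hi y (Finset.mem_insert_self _ _)
      · exact absurd (hi _ (Finset.mem_insert_of_mem (hm i))) (not_le.2 (hz i hij))
  · rintro ⟨j, hinj, habove, hmax⟩
    constructor
    · intro hyQ
      -- The minimizers other than the one of `j` exhaust `Q`, so a `y` in `Q` would have to exceed
      -- itself.
      have himg : (Finset.univ.erase j).image m = Q := by
        apply Finset.eq_of_subset_of_card_le
        · intro x hx
          obtain ⟨i, -, rfl⟩ := Finset.mem_image.1 hx
          exact hm i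
        · have hinj' : Set.InjOn m (Finset.univ.erase j : Finset I) := fun i hi k hk h =>
              hinj (Finset.ne_of_mem_erase hi) (Finset.ne_of_mem_erase hk) h
          rw [Finset.card_image_of_injOn hinj', Finset.card_erase_of_mem (Finset.mem_univ _),
            Finset.card_univ]
          omega
      rw [← himg] at hyQ
      obtain ⟨i, hi, rfl⟩ := Finset.mem_image.1 hyQ
      exact lt_irrefl _ (habove i (Finset.ne_of_mem_erase hi))
    · intro z
      by_cases hz : ∀ i, i ≠ j → r i (m i) < r i z
      · obtain ⟨i, hi⟩ := hdom z
        have hij : i = j := by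
          by_contra hij
          exact absurd (hi _ (hm i)) (not_le.2 (hz i hij))
        subst hij
        exact ⟨i, Finset.forall_mem_insert _ _ _ |>.2 ⟨hmax z hz, hi⟩⟩
      · push Not at hz
        obtain ⟨i, hij, hi⟩ := hz
        exact ⟨i, Finset.forall_mem_insert _ _ _ |>.2
          ⟨hi.trans (habove i hij).le, fun x hx => hi.trans (hmin i x hx)⟩⟩

/-- If every ranking leaves room above the minima, then a dominant set with `|I| - 1` elements
has exactly two extensions to a dominant set with `|I|` elements. -/
lemma card_dominant_insert_eq_two {V I : Type*} [Fintype I] [Fintype V]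
    [DecidableEq I] [DecidableEq V]
    {r : I → V → ℕ} (hr : ∀ i, Function.Injective (r i)) {Q : Finset V}
    (hcard : Q.card + 1 = Fintype.card I) (hdom : Dominant r Q) (m : I → V) (hm : ∀ i, m i ∈ Q)
    (hmin : ∀ i, ∀ x ∈ Q, r i (m i) ≤ r i x)
    (hab : ∀ j, ∃ y, ∀ i, i ≠ j → r i (m i) < r i y)
    [DecidablePred fun y => y ∉ Q ∧ Dominant r (insert y Q)] :
    (Finset.univ.filter fun y => y ∉ Q ∧ Dominant r (insert y Q)).card = 2 := by
  classical
  have hsurj : ∀ q ∈ Q, ∃ i, m i = q := by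
    intro q hq
    obtain ⟨i, hi⟩ := hdom q
    exact ⟨i, hr i (le_antisymm (hmin i q hq) (hi _ (hm i)))⟩
  obtain ⟨a, b, hne, heq, hpair⟩ := exists_unique_collision hcard m hm hsurj
  have hmax : ∀ j, ∃ y, (∀ i, i ≠ j → r i (m i) < r i y) ∧
      ∀ z, (∀ i, i ≠ j → r i (m i) < r i z) → r j z ≤ r j y := by
    intro j
    obtain ⟨y0, hy0⟩ := hab j
    obtain ⟨y, hy, hymax⟩ := Finset.exists_max_image
      (Finset.univ.filter fun y => ∀ i, i ≠ j → r i (m i) < r i y) (r j)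
      ⟨y0, by simpa using hy0⟩
    exact ⟨y, by simpa using hy, fun z hz => hymax z (by simpa using hz)⟩
  choose f hf hfmax using hmax
  rw [Finset.card_eq_two]
  refine ⟨f a, f b, fun h => ?_, ?_⟩
  -- If the two candidates coincided, that point would exceed the minimum over `Q` in every ranking,
  -- against dominance.
  · obtain ⟨i, hi⟩ := hdom (f a)
    by_cases hia : i = a
    · subst hia
      exact absurd (hi _ (hm i)) (not_le.2 (h ▸ hf b i hne))
    · exact absurd (hi _ (hm i)) (not_le.2 (hf a i hia))
  · ext y
    simp only [Finset.mem_filter, Finset.mem_univ, true_and, Finset.mem_insert,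
      Finset.mem_singleton]
    rw [dominant_insert_iff hr hcard hdom m hm hmin]
    constructor
    · rintro ⟨j, hj, h1, h2⟩
      have : y = f j := hr j (le_antisymm (hfmax j y h1) (h2 _ (hf j)))
      rcases (hpair j).2 hj with rfl | rfl
      · exact Or.inl this
      · exact Or.inr this
    · rintro (rfl | rfl)
      · exact ⟨a, (hpair a).1 (Or.inl rfl), hf a, hfmax a⟩
      · exact ⟨b, (hpair b).1 (Or.inr rfl), hf b, hfmax b⟩

/-- A colouring of a set `P` with `|I|` elements that misses a colour admits an even number of
elements whose removal leaves every colour but `i₀` exactly once. -/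
lemma even_card_erase_image {V I : Type*} [Fintype I] [DecidableEq I] [DecidableEq V]
    {P : Finset V} (hcard : P.card = Fintype.card I) (c : V → I) (i₀ : I)
    (hP : P.image c ≠ Finset.univ) :
    Even (P.filter fun x => (P.erase x).image c = Finset.univ.erase i₀).card := by
  rcases (P.filter fun x => (P.erase x).image c = Finset.univ.erase i₀).eq_empty_or_nonempty
    with h | ⟨x, hx⟩
  · simp [h]
  rw [Finset.mem_filter] at hx
  obtain ⟨hxP, hx⟩ := hx
  have hinj : Set.InjOn c (P.erase x : Finset V) := by
    rw [← Finset.card_image_iff, hx, Finset.card_erase_of_mem (Finset.mem_univ _),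
      Finset.card_erase_of_mem hxP, hcard, Finset.card_univ]
  have himg : P.image c = insert (c x) (Finset.univ.erase i₀) := by
    rw [← hx, ← Finset.image_insert, Finset.insert_erase hxP]
  have hcx : c x ≠ i₀ := by
    intro h
    apply hP
    rw [himg, h, Finset.insert_erase (Finset.mem_univ _)]
  have : c x ∈ (P.erase x).image c := by rw [hx]; simp [hcx]
  -- The colour of `x` recurs at exactly one other element `x'`. These two can be exchanged, while
  -- removing any third element would lose its colour.
  obtain ⟨x', hx', hcx'⟩ := Finset.mem_image.1 this
  have hne : x ≠ x' := (Finset.ne_of_mem_erase hx').symm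
  have hx'P := Finset.mem_of_mem_erase hx'
  suffices h : (P.filter fun x => (P.erase x).image c = Finset.univ.erase i₀) = {x, x'} by
    rw [h, Finset.card_pair hne]; exact even_two
  ext y
  simp only [Finset.mem_filter, Finset.mem_insert, Finset.mem_singleton]
  constructor
  · rintro ⟨hyP, hy⟩
    by_contra hyne
    push Not at hyne
    have h1 : c y ∈ Finset.univ.erase i₀ := by
      rw [← hx]
      exact Finset.mem_image_of_mem c (Finset.mem_erase.2 ⟨hyne.1, hyP⟩)
    rw [← hy] at h1
    obtain ⟨z, hz, hzy⟩ := Finset.mem_image.1 h1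
    have hyx : y ∈ P.erase x := Finset.mem_erase.2 ⟨hyne.1, hyP⟩
    by_cases hzx : z = x
    · subst hzx
      exact hyne.2 (hinj hyx hx' (hzy.symm.trans hcx'.symm))
    · exact Finset.ne_of_mem_erase hz
        (hinj (Finset.mem_erase.2 ⟨hzx, Finset.mem_of_mem_erase hz⟩) hyx hzy)
  · rintro (rfl | rfl)
    · exact ⟨hxP, hx⟩
    · refine ⟨hx'P, ?_⟩
      rw [← hx]
      ext i
      simp only [Finset.mem_image, Finset.mem_erase]
      constructor
      · rintro ⟨z, ⟨hz1, hz2⟩, rfl⟩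
        by_cases hzx : z = x
        · exact ⟨y, ⟨hne.symm, hx'P⟩, by rw [hzx, hcx']⟩
        · exact ⟨z, ⟨hzx, hz2⟩, rfl⟩
      · rintro ⟨z, ⟨hz1, hz2⟩, rfl⟩
        by_cases hzx : z = y
        · exact ⟨x, ⟨hne, hxP⟩, by rw [hzx, hcx']⟩
        · exact ⟨z, ⟨hzx, hz2⟩, rfl⟩

/-- **Scarf's lemma**: for rankings of `T` together with one slack element per index, each
slack being lowest in its own ranking and above `T` in all others, every colouring giving each
slack its own index as colour admits a dominant set that carries every colour exactly once. -/
theorem exists_dominant_rainbow {T I : Type*} [Fintype T] [Fintype I] [Nonempty T] [Nonempty I]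
    [DecidableEq T] [DecidableEq I]
    (r : I → T ⊕ I → ℕ) (hr : ∀ i, Function.Injective (r i))
    (hlow : ∀ i t, r i (Sum.inr i) < r i (Sum.inl t))
    (hhigh : ∀ i j t, i ≠ j → r i (Sum.inl t) < r i (Sum.inr j))
    (c : T ⊕ I → I) (hc : ∀ i, c (Sum.inr i) = i) :
    ∃ P : Finset (T ⊕ I), P.card = Fintype.card I ∧ Dominant r P ∧ P.image c = Finset.univ := by
  classical
  obtain ⟨i₀⟩ := ‹Nonempty I›
  by_contra hno
  push Not at hno
  -- Incidences between doors and rooms are counted twice. A room that misses a colour has an even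
  -- number of doors; every door lies in two rooms, except one exterior door that lies in a single
  -- room.
  let rooms : Finset (Finset (T ⊕ I)) :=
    Finset.univ.filter fun P => P.card = Fintype.card I ∧ Dominant r P
  let doors : Finset (Finset (T ⊕ I)) := Finset.univ.filter fun Q =>
    Q.card + 1 = Fintype.card I ∧ Dominant r Q ∧ Q.image c = Finset.univ.erase i₀
  have hrooms : ∀ P, P ∈ rooms ↔ P.card = Fintype.card I ∧ Dominant r P := by simp [rooms]
  have hdoors : ∀ Q, Q ∈ doors ↔ Q.card + 1 = Fintype.card I ∧ Dominant r Q ∧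
      Q.image c = Finset.univ.erase i₀ := by simp [doors]
  have hcount := Finset.sum_card_bipartiteAbove_eq_sum_card_bipartiteBelow
    (s := doors) (t := rooms) (fun Q P => Q ⊆ P)
  have habove : ∀ Q ∈ doors, (rooms.bipartiteAbove (fun Q P => Q ⊆ P) Q).card =
      (Finset.univ.filter fun y => y ∉ Q ∧ Dominant r (insert y Q)).card := by
    intro Q hQ
    rw [hdoors] at hQ
    symm
    refine Finset.card_bij (fun y _ => insert y Q) ?_ ?_ ?_
    · intro y hy
      simp only [Finset.mem_filter, Finset.mem_univ, true_and] at hy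
      simp only [Finset.mem_bipartiteAbove, hrooms]
      exact ⟨⟨by rw [Finset.card_insert_of_notMem hy.1, hQ.1], hy.2⟩, Finset.subset_insert _ _⟩
    · intro y hy z hz hyz
      simp only [Finset.mem_filter, Finset.mem_univ, true_and] at hy hz
      have : y ∈ insert z Q := hyz ▸ Finset.mem_insert_self _ _
      exact (Finset.mem_insert.1 this).resolve_right hy.1
    · intro P hP
      simp only [Finset.mem_bipartiteAbove, hrooms] at hP
      obtain ⟨y, hy⟩ := Finset.exists_eq_insert_iff.2 ⟨hP.2, by rw [hP.1.1, hQ.1]⟩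
      refine ⟨y, ?_, hy.2⟩
      simp only [Finset.mem_filter, Finset.mem_univ, true_and]
      exact ⟨hy.1, hy.2 ▸ hP.1.2⟩
  have hbelow : ∀ P ∈ rooms, (doors.bipartiteBelow (fun Q P => Q ⊆ P) P).card =
      (P.filter fun x => (P.erase x).image c = Finset.univ.erase i₀).card := by
    intro P hP
    rw [hrooms] at hP
    symm
    refine Finset.card_bij (fun x _ => P.erase x) ?_ ?_ ?_
    · intro x hx
      rw [Finset.mem_filter] at hx
      simp only [Finset.mem_bipartiteBelow, hdoors]
      refine ⟨⟨?_, hP.2.mono (Finset.erase_subset _ _), hx.2⟩, Finset.erase_subset _ _⟩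
      rw [Finset.card_erase_add_one hx.1, hP.1]
    · intro x hx z hz hxz
      rw [Finset.mem_filter] at hx hz
      exact Finset.erase_injOn P hx.1 hz.1 hxz
    · intro Q hQ
      simp only [Finset.mem_bipartiteBelow, hdoors] at hQ
      obtain ⟨y, hy⟩ := Finset.exists_eq_insert_iff.2 ⟨hQ.2, by rw [hP.1, hQ.1.1]⟩
      have hyQ : P.erase y = Q := by rw [← hy.2, Finset.erase_insert hy.1]
      refine ⟨y, ?_, hyQ⟩
      rw [Finset.mem_filter, hyQ, ← hy.2]
      exact ⟨Finset.mem_insert_self _ _, hQ.1.2.2⟩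
  have hright : Even (∑ P ∈ rooms, (doors.bipartiteBelow (fun Q P => Q ⊆ P) P).card) := by
    refine Finset.even_sum _ fun P hP => ?_
    rw [hbelow P hP]
    rw [hrooms] at hP
    exact even_card_erase_image hP.1 c i₀ (hno P hP.1 hP.2)
  -- The exterior door: all slacks but that of `i₀`. Its only extension adds the element of `T` that
  -- is highest in the ranking `i₀`.
  let S : Finset (T ⊕ I) := (Finset.univ.erase i₀).image Sum.inr
  have hSmem : ∀ x, x ∈ S ↔ ∃ i, i ≠ i₀ ∧ x = Sum.inr i := by
    intro x; simp [S, eq_comm]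
  have hSdom : Dominant r S := by
    rintro (t | j)
    · refine ⟨i₀, fun x hx => ?_⟩
      obtain ⟨i, hi, rfl⟩ := (hSmem x).1 hx
      exact (hhigh _ _ _ hi.symm).le
    · refine ⟨j, fun x hx => ?_⟩
      obtain ⟨i, hi, rfl⟩ := (hSmem x).1 hx
      by_cases hij : j = i
      · rw [hij]
      · obtain ⟨t⟩ := ‹Nonempty T›
        exact ((hlow j t).trans (hhigh _ _ _ hij)).le
  have hSdoor : S ∈ doors := by
    rw [hdoors]
    refine ⟨?_, hSdom, ?_⟩
    · rw [Finset.card_image_of_injective _ Sum.inr_injective,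
        Finset.card_erase_add_one (Finset.mem_univ _), Finset.card_univ]
    · rw [Finset.image_image]
      have hid : c ∘ Sum.inr = id := funext hc
      rw [hid, Finset.image_id]
  have hSone : (Finset.univ.filter fun y => y ∉ S ∧ Dominant r (insert y S)).card = 1 := by
    obtain ⟨t₀, ht₀⟩ := Finite.exists_max fun t => r i₀ (Sum.inl t)
    rw [Finset.card_eq_one]
    refine ⟨Sum.inl t₀, ?_⟩
    have hiff : ∀ y, (y ∉ S ∧ Dominant r (insert y S)) ↔ y = Sum.inl t₀ := by
      intro y
      constructor
      · rintro ⟨hy, hd⟩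
        obtain ⟨i, hi⟩ := hd (Sum.inl t₀)
        have hii : i = i₀ := by
          by_contra hne
          exact absurd (hi (Sum.inr i) (Finset.mem_insert_of_mem ((hSmem _).2 ⟨i, hne, rfl⟩)))
            (not_le.2 (hlow _ _))
        subst hii
        have h1 := hi y (Finset.mem_insert_self _ _)
        rcases y with t | j
        · exact hr i (le_antisymm (ht₀ t) h1)
        · by_cases hj : j = i
          · subst hj
            exact absurd h1 (not_le.2 (hlow _ _))
          · exact absurd ((hSmem _).2 ⟨j, hj, rfl⟩) hy
      · rintro rfl
        refine ⟨fun h => ?_, ?_⟩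
        · obtain ⟨i, -, h⟩ := (hSmem _).1 h
          simp at h
        · rintro (t | j)
          · refine ⟨i₀, fun x hx => ?_⟩
            rcases Finset.mem_insert.1 hx with rfl | hx
            · exact ht₀ t
            · obtain ⟨i, hi, rfl⟩ := (hSmem x).1 hx
              exact (hhigh _ _ _ hi.symm).le
          · refine ⟨j, fun x hx => ?_⟩
            rcases Finset.mem_insert.1 hx with rfl | hx
            · exact (hlow _ _).le
            · obtain ⟨i, hi, rfl⟩ := (hSmem x).1 hx
              by_cases hij : j = i
              · rw [hij]
              · exact ((hlow j t₀).trans (hhigh _ _ _ hij)).le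
    ext y
    simp only [Finset.mem_filter, Finset.mem_univ, true_and, Finset.mem_singleton]
    exact hiff y
  have htwo : ∀ Q ∈ doors.erase S,
      (Finset.univ.filter fun y => y ∉ Q ∧ Dominant r (insert y Q)).card = 2 := by
    intro Q hQ
    obtain ⟨hQS, hQ⟩ := Finset.mem_erase.1 hQ
    rw [hdoors] at hQ
    obtain ⟨hQcard, hQdom, hQimg⟩ := hQ
    -- A door made of slacks alone has no slack of colour `i₀`, so by size it is `S`. In any other
    -- door a member from `T` keeps the minima low, and the slack of `j` lies above them in all
    -- rankings but `j`.
    have hT : ∃ t, Sum.inl t ∈ Q := by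
      by_contra hT
      push Not at hT
      apply hQS
      apply Finset.eq_of_subset_of_card_le
      · rintro (t | i) hx
        · exact absurd hx (hT t)
        · refine (hSmem _).2 ⟨i, ?_, rfl⟩
          have : c (Sum.inr i) ∈ Finset.univ.erase i₀ := hQimg ▸ Finset.mem_image_of_mem c hx
          rw [hc] at this
          exact Finset.ne_of_mem_erase this
      · have := ((hdoors S).1 hSdoor).1
        omega
    obtain ⟨t, ht⟩ := hT
    have hmin : ∀ i, ∃ x ∈ Q, ∀ z ∈ Q, r i x ≤ r i z := fun i =>
      Finset.exists_min_image _ (r i) ⟨_, ht⟩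
    choose m hm hmmin using hmin
    refine card_dominant_insert_eq_two hr hQcard hQdom m hm hmmin fun j => ⟨Sum.inr j, ?_⟩
    intro i hij
    exact (hmmin i _ ht).trans_lt (hhigh i j t hij)
  have hleft : Odd (∑ Q ∈ doors, (rooms.bipartiteAbove (fun Q P => Q ⊆ P) Q).card) := by
    rw [Finset.sum_congr rfl habove, ← Finset.add_sum_erase _ _ hSdoor, hSone,
      Finset.sum_congr rfl htwo, Finset.sum_const, smul_eq_mul, add_comm]
    exact Even.add_one (even_two.mul_left _)
  rw [hcount] at hleft
  exact Nat.not_odd_iff_even.2 hright hleft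

end Scarf

end SVMGame

namespace SVMGame

/-! ### From Scarf's lemma on grids to the dual KKM theorem. -/

section DualKKM

/-- The points of the simplex `∑ i, x i = N` with natural number coordinates. -/
abbrev GridSimplex (I : Type*) [Fintype I] (N : ℕ) : Type _ :=
  {x : I → Fin (N + 1) // ∑ i, (x i : ℕ) = N}

/-- The ranking of grid points by their `i`-th coordinate, with ties broken by an enumeration,
extended to slack elements. -/
noncomputable def gridRank {I : Type*} [Fintype I] [DecidableEq I] (N : ℕ) (i : I) :
    GridSimplex I N ⊕ I → ℕ
  | Sum.inl t => 1 + (Fintype.card (GridSimplex I N) * (t.1 i : ℕ) +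
      (Fintype.equivFin (GridSimplex I N) t : ℕ))
  | Sum.inr j => if j = i then 0 else
      1 + Fintype.card (GridSimplex I N) * (N + 1) + (Fintype.equivFin I j : ℕ)

lemma gridRank_inl_lt {I : Type*} [Fintype I] [DecidableEq I] (N : ℕ) (i : I)
    (t : GridSimplex I N) :
    gridRank N i (Sum.inl t) < 1 + Fintype.card (GridSimplex I N) * (N + 1) := by
  have h1 := (t.1 i).is_lt
  have h2 := (Fintype.equivFin (GridSimplex I N) t).is_lt
  simp only [gridRank]
  nlinarith [Nat.mul_le_mul_left (Fintype.card (GridSimplex I N)) (Nat.le_of_lt_succ h1)]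

/-- The tie-breaking index is smaller than the number of grid points, so it cannot offset a whole
unit of the coordinate. -/
lemma coord_le_of_gridRank_le {I : Type*} [Fintype I] [DecidableEq I] {N : ℕ} {i : I}
    {s t : GridSimplex I N} (h : gridRank N i (Sum.inl s) ≤ gridRank N i (Sum.inl t)) :
    (s.1 i : ℕ) ≤ (t.1 i : ℕ) := by
  have h2 := (Fintype.equivFin (GridSimplex I N) t).is_lt
  simp only [gridRank] at h
  by_contra hlt
  push Not at hlt
  have := Nat.mul_le_mul_left (Fintype.card (GridSimplex I N)) (Nat.succ_le_of_lt hlt)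
  rw [Nat.mul_succ] at this
  omega

lemma gridRank_injective {I : Type*} [Fintype I] [DecidableEq I] (N : ℕ) (i : I) :
    Function.Injective (gridRank (I := I) N i) := by
  rintro (s | j) (t | k) h
  · have hc : (s.1 i : ℕ) = t.1 i :=
      le_antisymm (coord_le_of_gridRank_le h.le) (coord_le_of_gridRank_le h.ge)
    simp only [gridRank, hc] at h
    have : Fintype.equivFin (GridSimplex I N) s = Fintype.equivFin (GridSimplex I N) t :=
      Fin.ext (by omega)
    rw [(Fintype.equivFin _).injective this]
  · have h1 := gridRank_inl_lt N i s
    rw [h] at h1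
    by_cases hk : k = i
    · simp [gridRank, hk] at h
    · simp only [gridRank, if_neg hk] at h1; omega
  · have h1 := gridRank_inl_lt N i t
    rw [← h] at h1
    by_cases hk : j = i
    · simp only [gridRank, if_pos hk] at h; omega
    · simp only [gridRank, if_neg hk] at h1; omega
  · simp only [gridRank] at h
    split_ifs at h with h1 h2 h2
    · rw [h1, h2]
    · omega
    · omega
    · have : Fintype.equivFin I j = Fintype.equivFin I k := Fin.ext (by omega)
      rw [(Fintype.equivFin _).injective this]

/-- Every colouring of the grid simplex has a point that is close to each colour or to the face
opposite to it. -/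
theorem exists_grid_point {I : Type*} [Fintype I] [Nonempty I] (N : ℕ)
    (c : GridSimplex I N → I) :
    ∃ x : GridSimplex I N, ∀ i, (∃ x' : GridSimplex I N, c x' = i ∧
      ∀ j, (x.1 j : ℕ) ≤ x'.1 j + Fintype.card I ∧ (x'.1 j : ℕ) ≤ x.1 j + Fintype.card I) ∨
      (x.1 i : ℕ) ≤ Fintype.card I := by
  classical
  have hT : ∀ y : I → ℕ, ∑ i, y i = N → ∃ t : GridSimplex I N, ∀ i, (t.1 i : ℕ) = y i := by
    intro y hy
    refine ⟨⟨fun i => ⟨y i, ?_⟩, hy⟩, fun i => rfl⟩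
    have := Finset.single_le_sum (f := y) (fun i _ => Nat.zero_le _) (Finset.mem_univ i)
    omega
  have hTne : Nonempty (GridSimplex I N) := by
    obtain ⟨i⟩ := ‹Nonempty I›
    obtain ⟨t, -⟩ := hT (Pi.single i N) (by simp)
    exact ⟨t⟩
  obtain ⟨P, -, hdom, hcol⟩ := exists_dominant_rainbow (gridRank (I := I) N)
    (gridRank_injective N) (fun i t => by simp [gridRank])
    (fun i j t hij => by
      have := gridRank_inl_lt N i t
      have h2 : gridRank N i (Sum.inr j : GridSimplex I N ⊕ I) =
        1 + Fintype.card (GridSimplex I N) * (N + 1) + (Fintype.equivFin I j : ℕ) := by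
          simp [gridRank, hij.symm]
      omega)
    (Sum.elim c id) (fun i => rfl)
  have hattain : ∀ i, Sum.inr i ∈ P ∨ ∃ x, Sum.inl x ∈ P ∧ c x = i := by
    intro i
    have : i ∈ P.image (Sum.elim c id) := hcol ▸ Finset.mem_univ i
    obtain ⟨x | j, hx, hxi⟩ := Finset.mem_image.1 this
    · exact Or.inr ⟨x, hx, hxi⟩
    · simp only [Sum.elim_inr, id] at hxi
      exact Or.inl (hxi ▸ hx)
  -- A slack in `P` has rank zero in its own ranking, so that ranking cannot witness dominance over
  -- a grid point.
  have hdom' : ∀ y : GridSimplex I N, ∃ i, Sum.inr i ∉ P ∧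
      ∀ x : GridSimplex I N, Sum.inl x ∈ P → (y.1 i : ℕ) ≤ x.1 i := by
    intro y
    obtain ⟨i, hi⟩ := hdom (Sum.inl y)
    refine ⟨i, fun h => ?_, fun x hx => coord_le_of_gridRank_le (hi _ hx)⟩
    have := hi _ h
    simp [gridRank] at this
  obtain ⟨i₁, hi₁, -⟩ := hdom' (Classical.arbitrary _)
  obtain ⟨x₀, hx₀, -⟩ := (hattain i₁).resolve_left hi₁
  have hmin : ∀ i, ∃ z : GridSimplex I N, Sum.inl z ∈ P ∧
      ∀ x : GridSimplex I N, Sum.inl x ∈ P → (z.1 i : ℕ) ≤ x.1 i := by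
    intro i
    obtain ⟨z, hz, hzmin⟩ := Finset.exists_min_image
      (Finset.univ.filter fun x : GridSimplex I N => Sum.inl x ∈ P) (fun x => (x.1 i : ℕ))
      ⟨x₀, by simpa using hx₀⟩
    exact ⟨z, by simpa using hz, fun x hx => hzmin x (by simpa using hx)⟩
  choose z hzP hzmin using hmin
  -- `b` bounds the grid points of `P` from below, with zero where the slack is present; `a` is one
  -- more than the minimum where it is absent.
  let a : I → ℕ := fun i => if Sum.inr i ∉ P then (z i).1 i + 1 else 0
  let b : I → ℕ := fun i => if Sum.inr i ∉ P then (z i).1 i else 0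
  -- Otherwise a grid point above `a` exists (the surplus is put on `i₁`), and it contradicts
  -- dominance. So `b` sums to at least `N` minus the number of indices, which confines all grid
  -- points of `P` to a small box above `b`.
  have ha : N < ∑ i, a i := by
    by_contra hle
    push Not at hle
    obtain ⟨y, hy⟩ := hT (fun i => a i + (Pi.single i₁ (N - ∑ i, a i) : I → ℕ) i) (by
      rw [Finset.sum_add_distrib]; simp; omega)
    obtain ⟨i, hi, hiy⟩ := hdom' y
    have := hiy _ (hzP i)
    rw [hy] at this
    simp only [a, if_pos hi] at this
    omega
  have hab : ∑ i, a i ≤ ∑ i, b i + Fintype.card I := by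
    rw [← Finset.card_univ, Finset.card_eq_sum_ones, ← Finset.sum_add_distrib]
    refine Finset.sum_le_sum fun i _ => ?_
    simp only [a, b]
    split_ifs <;> omega
  have hb : ∀ x : GridSimplex I N, Sum.inl x ∈ P → ∀ j, b j ≤ x.1 j := by
    intro x hx j
    simp only [b]
    split_ifs
    · exact Nat.zero_le _
    · exact hzmin j x hx
  have hub : ∀ x : GridSimplex I N, Sum.inl x ∈ P → ∀ j, (x.1 j : ℕ) ≤ b j + Fintype.card I := by
    intro x hx j
    have h1 := x.2
    rw [← Finset.add_sum_erase _ _ (Finset.mem_univ j)] at h1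
    have h2 : ∑ i ∈ Finset.univ.erase j, b i ≤ ∑ i ∈ Finset.univ.erase j, (x.1 i : ℕ) :=
      Finset.sum_le_sum fun i _ => hb x hx i
    have h3 := Finset.add_sum_erase Finset.univ b (Finset.mem_univ j)
    omega
  refine ⟨x₀, fun i => ?_⟩
  by_cases hi : Sum.inr i ∈ P
  · right
    have := hub x₀ hx₀ i
    simpa [b, hi] using this
  · left
    obtain ⟨x', hx', hcx⟩ := (hattain i).resolve_left hi
    exact ⟨x', hcx, fun j => ⟨(hub x₀ hx₀ j).trans (Nat.add_le_add_right (hb x' hx' j) _),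
      (hub x' hx' j).trans (Nat.add_le_add_right (hb x₀ hx₀ j) _)⟩⟩

/-- Approximate form of the dual Knaster–Kuratowski–Mazurkiewicz theorem. -/
lemma exists_approx_mem_iInter {I : Type*} [Fintype I] [Nonempty I] (C : I → Set (I → ℝ))
    (hcover : ∀ x ∈ stdSimplex ℝ I, ∃ i, x ∈ C i) (N : ℕ) :
    ∃ x ∈ stdSimplex ℝ I, ∀ i,
      (∃ x' ∈ C i, dist x' x ≤ Fintype.card I / ((N : ℝ) + 1)) ∨
      x i ≤ Fintype.card I / ((N : ℝ) + 1) := by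
  have hN : (0 : ℝ) < (N : ℝ) + 1 := by positivity
  -- The mesh is indexed by `N + 1` so that the scaling never divides by zero.
  let e : GridSimplex I (N + 1) → I → ℝ := fun t i => (t.1 i : ℕ) / ((N : ℝ) + 1)
  have he : ∀ t, e t ∈ stdSimplex ℝ I := by
    intro t
    refine ⟨fun i => by positivity, ?_⟩
    simp only [e]
    rw [← Finset.sum_div, ← Nat.cast_sum, t.2]
    push_cast
    exact div_self hN.ne'
  choose c hc using fun t => hcover (e t) (he t)
  obtain ⟨x, hx⟩ := exists_grid_point (N + 1) c
  refine ⟨e x, he x, fun i => ?_⟩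
  rcases hx i with ⟨x', hx', hclose⟩ | h
  · refine Or.inl ⟨e x', hx' ▸ hc x', ?_⟩
    rw [dist_pi_le_iff (by positivity)]
    intro j
    simp only [e]
    rw [Real.dist_eq, ← sub_div, abs_div, abs_of_pos hN]
    gcongr
    obtain ⟨h1, h2⟩ := hclose j
    rw [abs_le]
    have h1' : ((x.1 j : ℕ) : ℝ) ≤ (x'.1 j : ℕ) + Fintype.card I := by exact_mod_cast h1
    have h2' : ((x'.1 j : ℕ) : ℝ) ≤ (x.1 j : ℕ) + Fintype.card I := by exact_mod_cast h2
    constructor <;> linarith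
  · right
    simp only [e]
    gcongr

/-- **Dual KKM theorem**: closed sets that cover a simplex, each containing the face opposite to
its vertex, have a common point in the simplex. -/
theorem exists_mem_iInter_of_face_subset {I : Type*} [Fintype I] [Nonempty I]
    (C : I → Set (I → ℝ)) (hclosed : ∀ i, IsClosed (C i))
    (hcover : ∀ x ∈ stdSimplex ℝ I, ∃ i, x ∈ C i)
    (hface : ∀ i, ∀ x ∈ stdSimplex ℝ I, x i = 0 → x ∈ C i) :
    ∃ x ∈ stdSimplex ℝ I, ∀ i, x ∈ C i := by
  choose u hu huC using exists_approx_mem_iInter C hcover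
  obtain ⟨x, hx, φ, hφ, hlim⟩ := (isCompact_stdSimplex ℝ I).tendsto_subseq hu
  refine ⟨x, hx, fun i => ?_⟩
  have hε : Filter.Tendsto (fun N : ℕ => (Fintype.card I : ℝ) / ((φ N : ℝ) + 1))
      Filter.atTop (nhds 0) := by
    have h1 : Filter.Tendsto (fun N : ℕ => (Fintype.card I : ℝ) / ((N : ℝ) + 1))
        Filter.atTop (nhds 0) :=
      Filter.Tendsto.div_atTop tendsto_const_nhds
        (Filter.tendsto_atTop_add_const_right _ _ tendsto_natCast_atTop_atTop)
    exact h1.comp hφ.tendsto_atTop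
  by_cases hxi : x i = 0
  · exact hface i x hx hxi
  have hpos : 0 < x i := lt_of_le_of_ne (hx.1 i) (Ne.symm hxi)
  have hlimi : Filter.Tendsto (fun N => u (φ N) i) Filter.atTop (nhds (x i)) :=
    ((continuous_apply i).tendsto x).comp hlim
  -- At a limit with positive `i`-th coordinate the near-face alternative eventually fails, so
  -- points of `C i` approach `x`; a zero coordinate is covered by `hface`.
  have hev : ∀ᶠ N in Filter.atTop, (Fintype.card I : ℝ) / ((φ N : ℝ) + 1) < u (φ N) i :=
    hε.eventually_lt hlimi hpos
  rw [← (hclosed i).closure_eq, Metric.mem_closure_iff]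
  intro ε hεpos
  have h1 : ∀ᶠ N in Filter.atTop, (Fintype.card I : ℝ) / ((φ N : ℝ) + 1) < ε / 2 :=
    hε.eventually_lt_const (by positivity)
  have h2 : ∀ᶠ N in Filter.atTop, dist (u (φ N)) x < ε / 2 :=
    (Metric.tendsto_nhds.1 hlim) _ (by positivity)
  obtain ⟨N, hN, hN1, hN2⟩ := (hev.and (h1.and h2)).exists
  obtain ⟨x', hx', hd⟩ := (huC (φ N) i).resolve_right (not_le.2 hN)
  refine ⟨x', hx', ?_⟩
  have h3 := dist_triangle x' (u (φ N)) x
  rw [dist_comm x x']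
  linarith

end DualKKM

/-! ### Ky Fan's inequality and the existence of equilibria. -/

section FanInequality

/-- **Ky Fan's inequality** on finitely many points of a convex set. -/
lemma exists_le_of_finite {E : Type*} [AddCommGroup E] [Module ℝ E] [TopologicalSpace E]
    [ContinuousAdd E] [ContinuousSMul ℝ E] {K : Set E} (hK : Convex ℝ K) (Φ : E → E → ℝ)
    (hΦ : Continuous fun p : E × E => Φ p.1 p.2) (hconv : ∀ u ∈ K, ConvexOn ℝ K (Φ u))
    (s : Finset E) (hs : s.Nonempty) (hsK : ∀ v ∈ s, v ∈ K) :
    ∃ u ∈ K, ∀ v ∈ s, Φ u u ≤ Φ u v := by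
  have : Nonempty s := hs.to_subtype
  let p : (s → ℝ) → E := fun x => ∑ v, x v • (v : E)
  have hp : Continuous p := by fun_prop
  have hpK : ∀ x ∈ stdSimplex ℝ s, p x ∈ K := fun x hx =>
    hK.sum_mem (fun i _ => hx.1 i) hx.2 (fun v _ => hsK v v.2)
  -- `g v` is the gain from moving to `v`, as in Nash's map. The sets where `x v` times the total
  -- gain is at most `g v x` cover the simplex, because both sides have the same sum over `v`; at a
  -- common point they therefore agree for each `v`.
  let g : s → (s → ℝ) → ℝ := fun v x => max 0 (Φ (p x) (p x) - Φ (p x) v)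
  have hg : ∀ v, Continuous (g v) := fun v =>
    continuous_const.max ((hΦ.comp (hp.prodMk hp)).sub (hΦ.comp (hp.prodMk continuous_const)))
  have hg0 : ∀ v x, 0 ≤ g v x := fun v x => le_max_left _ _
  obtain ⟨x, hx, hxC⟩ := exists_mem_iInter_of_face_subset
    (fun v => {x : s → ℝ | x v * ∑ w, g w x ≤ g v x})
    (fun v => isClosed_le ((continuous_apply v).mul (continuous_finsetSum _ fun w _ => hg w))
      (hg v))
    (fun x hx => by
      by_contra hno
      push Not at hno
      have : ∑ v, g v x < ∑ v, x v * ∑ w, g w x :=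
        Finset.sum_lt_sum_of_nonempty Finset.univ_nonempty fun v _ => not_le.1 (hno v)
      rw [← Finset.sum_mul, hx.2, one_mul] at this
      exact lt_irrefl _ this)
    (fun v x _ hxv => by
      simp only [Set.mem_ofPred_eq, hxv, zero_mul]
      exact hg0 v x)
  simp only [Set.mem_ofPred_eq] at hxC
  have heq : ∀ v, x v * ∑ w, g w x = g v x := by
    have := (Finset.sum_eq_sum_iff_of_le (s := Finset.univ)
      (f := fun v => x v * ∑ w, g w x) (g := fun v => g v x) fun v _ => hxC v).1 (by
        rw [← Finset.sum_mul, hx.2, one_mul])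
    exact fun v => this v (Finset.mem_univ v)
  -- By convexity not every point of positive weight can lie strictly below the value at the
  -- barycentre `p x`. One with zero gain and positive weight forces the total gain to vanish.
  have hexists : ∃ v, 0 < x v ∧ Φ (p x) (p x) ≤ Φ (p x) v := by
    by_contra hno
    push Not at hno
    have h1 : Φ (p x) (p x) ≤ ∑ v, x v • Φ (p x) v :=
      (hconv _ (hpK x hx)).map_sum_le (fun v _ => hx.1 v) hx.2 (fun v _ => hsK v v.2)
    have h2 : ∑ v, x v • Φ (p x) v < ∑ v, x v * Φ (p x) (p x) := by
      refine Finset.sum_lt_sum (fun v _ => ?_) ?_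
      · rcases (hx.1 v).eq_or_lt with h | h
        · simp [← h]
        · exact mul_le_mul_of_nonneg_left (hno v h).le h.le
      · have : ∃ v, 0 < x v := by
          by_contra hz
          push Not at hz
          have := hx.2
          rw [Finset.sum_eq_zero fun v _ => le_antisymm (hz v) (hx.1 v)] at this
          exact zero_ne_one this
        obtain ⟨v, hv⟩ := this
        exact ⟨v, Finset.mem_univ _, mul_lt_mul_of_pos_left (hno v hv) hv⟩
    rw [← Finset.sum_mul, hx.2, one_mul] at h2
    linarith
  obtain ⟨v, hv, hle⟩ := hexists
  have hG : ∑ w, g w x = 0 := by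
    have h1 := heq v
    have h2 : g v x = 0 := max_eq_left (by linarith)
    rw [h2] at h1
    exact (mul_eq_zero.1 h1).resolve_left hv.ne'
  refine ⟨p x, hpK x hx, fun w hw => ?_⟩
  have h1 := heq ⟨w, hw⟩
  rw [hG, mul_zero] at h1
  have h2 : Φ (p x) (p x) - Φ (p x) w ≤ g ⟨w, hw⟩ x := le_max_right _ _
  linarith

/-- **Ky Fan's inequality** for a continuous bifunction that is convex in its second variable. -/
theorem exists_forall_le_of_convex {E : Type*} [AddCommGroup E] [Module ℝ E] [TopologicalSpace E]
    [T2Space E] [ContinuousAdd E] [ContinuousSMul ℝ E] {K : Set E} (hK : Convex ℝ K)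
    (hKc : IsCompact K) (hKne : K.Nonempty) (Φ : E → E → ℝ)
    (hΦ : Continuous fun p : E × E => Φ p.1 p.2) (hconv : ∀ u ∈ K, ConvexOn ℝ K (Φ u)) :
    ∃ u ∈ K, ∀ v ∈ K, Φ u u ≤ Φ u v := by
  classical
  have hne := hKc.inter_iInter_nonempty (fun v : K => {u | Φ u u ≤ Φ u v})
    (fun v => isClosed_le (hΦ.comp (continuous_id.prodMk continuous_id))
      (hΦ.comp (continuous_id.prodMk continuous_const)))
    (fun t => by
      obtain ⟨v₀, hv₀⟩ := hKne
      -- The extra point `v₀` keeps the finite set non-empty.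
      obtain ⟨u, huK, hu⟩ := exists_le_of_finite hK Φ hΦ hconv
        (insert v₀ (t.image Subtype.val)) (Finset.insert_nonempty _ _) (by
          intro v hv
          rcases Finset.mem_insert.1 hv with rfl | hv
          · exact hv₀
          · obtain ⟨w, -, rfl⟩ := Finset.mem_image.1 hv
            exact w.2)
      refine ⟨u, huK, Set.mem_iInter₂.2 fun v hv => ?_⟩
      exact hu v (Finset.mem_insert_of_mem (Finset.mem_image_of_mem _ hv)))
  obtain ⟨u, huK, hu⟩ := hne
  exact ⟨u, huK, fun v hv => Set.mem_iInter.1 hu ⟨v, hv⟩⟩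

/-- A two-player game on compact convex strategy sets, with jointly continuous costs that are
convex in the own strategy, has a Nash equilibrium. -/
theorem exists_isNashEquilibrium {E F : Type*}
    [AddCommGroup E] [Module ℝ E] [TopologicalSpace E] [T2Space E] [ContinuousAdd E]
    [ContinuousSMul ℝ E]
    [AddCommGroup F] [Module ℝ F] [TopologicalSpace F] [T2Space F] [ContinuousAdd F]
    [ContinuousSMul ℝ F] {A : Set E} {B : Set F}
    (hA : Convex ℝ A) (hAc : IsCompact A) (hAne : A.Nonempty)
    (hB : Convex ℝ B) (hBc : IsCompact B) (hBne : B.Nonempty) (cA cB : E → F → ℝ)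
    (hcA : Continuous fun p : E × F => cA p.1 p.2) (hcB : Continuous fun p : E × F => cB p.1 p.2)
    (hconvA : ∀ b ∈ B, ConvexOn ℝ A fun a => cA a b)
    (hconvB : ∀ a ∈ A, ConvexOn ℝ B fun b => cB a b) :
    ∃ a b, IsNashEquilibrium A B cA cB a b := by
  -- The bifunction lets each player deviate to `v` while the opponent stays at `u`. Changing only
  -- one component of `v` cancels the other player's cost.
  obtain ⟨⟨a, b⟩, ⟨ha, hb⟩, hle⟩ := exists_forall_le_of_convex (hA.prod hB) (hAc.prod hBc)
    (hAne.prod hBne) (fun u v => cA v.1 u.2 + cB u.1 v.2)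
    ((hcA.comp (by fun_prop : Continuous fun p : (E × F) × (E × F) => (p.2.1, p.1.2))).add
      (hcB.comp (by fun_prop : Continuous fun p : (E × F) × (E × F) => (p.1.1, p.2.2))))
    (fun u hu => by
      refine ⟨hA.prod hB, fun v hv w hw s t hs ht hst => ?_⟩
      have h1 := (hconvA u.2 hu.2).2 hv.1 hw.1 hs ht hst
      have h2 := (hconvB u.1 hu.1).2 hv.2 hw.2 hs ht hst
      simp only [smul_eq_mul, Prod.fst_add, Prod.snd_add, Prod.smul_fst, Prod.smul_snd] at *
      linarith)
  refine ⟨a, b, ha, hb, fun a' ha' => ?_, fun b' hb' => ?_⟩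
  · have := hle (a', b) ⟨ha', hb⟩
    simpa using this
  · have := hle (a, b') ⟨ha, hb'⟩
    simpa using this

end FanInequality

end SVMGame

namespace SVMGame

/-! ### Reparametrization of all profiles by one Gaussian noise. -/

section Sampling

instance isProbabilityMeasure_axisGaussian {d : ℕ} (θ : Params d) :
    IsProbabilityMeasure (axisGaussian θ) := by
  unfold axisGaussian; infer_instance

instance isProbabilityMeasure_learnerDist {k : ℕ} (θ : Params (k + 1)) :
    IsProbabilityMeasure (learnerDist θ) := by
  unfold learnerDist; infer_instance

instance isProbabilityMeasure_generatorDist {k n : ℕ} (θ : Fin n → Params k) :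
    IsProbabilityMeasure (generatorDist θ) := by
  unfold generatorDist; infer_instance

instance isProbabilityMeasure_jointDist {k n : ℕ} (θl : Params (k + 1)) (θd : Fin n → Params k) :
    IsProbabilityMeasure (jointDist θl θd) := by
  unfold jointDist; infer_instance

/-- The parameters of the standard Gaussian. -/
def stdParams (d : ℕ) : Params d := (0, 1)

/-- The affine map that sends a standard Gaussian vector to one with parameters `θ`. -/
def affineSample {d : ℕ} (θ : Params d) (ξ : Fin d → ℝ) : Fin d → ℝ := θ.1 + θ.2 * ξ

/-- The joint affine reparametrization of a pair of a weight vector and a tuple of samples. -/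
def jointSample {k n : ℕ} (θl : Params (k + 1)) (θd : Fin n → Params k)
    (p : (Fin (k + 1) → ℝ) × (Fin n → Fin k → ℝ)) : (Fin (k + 1) → ℝ) × (Fin n → Fin k → ℝ) :=
  (affineSample θl p.1, fun i => affineSample (θd i) (p.2 i))

/-- The law of the noise from which the samples of every profile are obtained. -/
noncomputable def noiseDist (k n : ℕ) : Measure ((Fin (k + 1) → ℝ) × (Fin n → Fin k → ℝ)) :=
  jointDist (stdParams (k + 1)) fun _ : Fin n => stdParams k

instance isProbabilityMeasure_noiseDist (k n : ℕ) : IsProbabilityMeasure (noiseDist k n) := by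
  unfold noiseDist; infer_instance

lemma continuous_affineSample {d : ℕ} :
    Continuous fun q : Params d × (Fin d → ℝ) => affineSample q.1 q.2 := by
  unfold affineSample; fun_prop

lemma measurable_affineSample {d : ℕ} (θ : Params d) : Measurable (affineSample θ) :=
  (continuous_affineSample.comp (continuous_const.prodMk continuous_id)).measurable

lemma continuous_jointSample_profile {k n : ℕ}
    (p : (Fin (k + 1) → ℝ) × (Fin n → Fin k → ℝ)) :
    Continuous fun θ : Params (k + 1) × (Fin n → Params k) => jointSample θ.1 θ.2 p := by
  unfold jointSample affineSample; fun_prop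

lemma continuous_jointSample {k n : ℕ} (θl : Params (k + 1)) (θd : Fin n → Params k) :
    Continuous (jointSample θl θd) := by
  unfold jointSample affineSample; fun_prop

/-- The sign of `σ` is immaterial because the law sees only its square; the noise representation
thus holds on the whole parameter space. -/
lemma gaussianReal_map_affine (μ σ : ℝ) :
    (gaussianReal 0 (Real.toNNReal (1 ^ 2))).map (fun x => μ + σ * x) =
      gaussianReal μ (Real.toNNReal (σ ^ 2)) := by
  have h : (fun x : ℝ => μ + σ * x) = (μ + ·) ∘ (σ * ·) := rfl
  rw [h, ← Measure.map_map (by fun_prop) (by fun_prop), gaussianReal_map_const_mul,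
    gaussianReal_map_const_add]
  congr 1
  · simp
  · ext
    simp [Real.coe_toNNReal _ (sq_nonneg σ)]

lemma axisGaussian_eq_map {d : ℕ} (θ : Params d) :
    axisGaussian θ = (axisGaussian (stdParams d)).map (affineSample θ) := by
  have hmap : ∀ j, (gaussianReal ((stdParams d).1 j) (Real.toNNReal ((stdParams d).2 j ^ 2))).map
      (fun x => θ.1 j + θ.2 j * x) = gaussianReal (θ.1 j) (Real.toNNReal (θ.2 j ^ 2)) :=
    fun j => gaussianReal_map_affine _ _
  have : ∀ j, SigmaFinite ((gaussianReal ((stdParams d).1 j)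
      (Real.toNNReal ((stdParams d).2 j ^ 2))).map (fun x => θ.1 j + θ.2 j * x)) := by
    intro j; rw [hmap]; infer_instance
  have h := Measure.pi_map_pi (μ := fun j => gaussianReal ((stdParams d).1 j)
    (Real.toNNReal ((stdParams d).2 j ^ 2))) (f := fun j x => θ.1 j + θ.2 j * x)
    (fun j => by fun_prop)
  simp_rw [hmap] at h
  exact h.symm

lemma generatorDist_eq_map {k n : ℕ} (θ : Fin n → Params k) :
    generatorDist θ = (generatorDist fun _ : Fin n => stdParams k).map
      (fun X i => affineSample (θ i) (X i)) := by
  have : ∀ i, SigmaFinite ((axisGaussian (stdParams k)).map (affineSample (θ i))) := by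
    intro i; rw [← axisGaussian_eq_map]; infer_instance
  have h := Measure.pi_map_pi (μ := fun _ : Fin n => axisGaussian (stdParams k))
    (f := fun i => affineSample (θ i)) (fun i => (measurable_affineSample _).aemeasurable)
  simp_rw [← axisGaussian_eq_map] at h
  exact h.symm

lemma jointDist_eq_map {k n : ℕ} (θl : Params (k + 1)) (θd : Fin n → Params k) :
    jointDist θl θd = (noiseDist k n).map (jointSample θl θd) := by
  have hd : Measurable fun (X : Fin n → Fin k → ℝ) i => affineSample (θd i) (X i) := by
    unfold affineSample; fun_prop
  unfold jointDist noiseDist jointDist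
  rw [generatorDist_eq_map θd, learnerDist, axisGaussian_eq_map θl,
    Measure.map_prod_map _ _ (measurable_affineSample θl) hd]
  rfl

/-- A finite product of laws with finite second moments has a finite second moment. -/
lemma memLp_id_pi {ι : Type*} [Fintype ι] {E : Type*} [NormedAddCommGroup E] [MeasurableSpace E]
    [BorelSpace E] [SecondCountableTopology E] (μ : ι → Measure E)
    [∀ i, IsProbabilityMeasure (μ i)] (h : ∀ i, MemLp id 2 (μ i)) :
    MemLp id 2 (Measure.pi μ) := by
  have h1 : ∀ i, MemLp (fun x : ι → E => ‖x i‖) 2 (Measure.pi μ) := fun i =>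
    ((h i).comp_measurePreserving (measurePreserving_eval μ i)).norm
  have h2 : MemLp (fun x : ι → E => ∑ i, ‖x i‖) 2 (Measure.pi μ) :=
    memLp_finsetSum _ fun i _ => h1 i
  refine h2.mono (measurable_id.aestronglyMeasurable) (Filter.Eventually.of_forall fun x => ?_)
  rw [Real.norm_of_nonneg (Finset.sum_nonneg fun i _ => norm_nonneg _)]
  exact pi_norm_le_iff_of_nonneg (Finset.sum_nonneg fun i _ => norm_nonneg _) |>.2 fun i =>
    Finset.single_le_sum (f := fun i => ‖x i‖) (fun i _ => norm_nonneg _) (Finset.mem_univ i)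

lemma memLp_id_axisGaussian {d : ℕ} (θ : Params d) : MemLp id 2 (axisGaussian θ) :=
  memLp_id_pi _ fun _ => memLp_id_gaussianReal' 2 (by simp)

/-- The product of two laws with finite second moments has a finite second moment. -/
lemma memLp_id_prod {E F : Type*} [NormedAddCommGroup E] [MeasurableSpace E] [BorelSpace E]
    [SecondCountableTopology E] [NormedAddCommGroup F] [MeasurableSpace F] [BorelSpace F]
    [SecondCountableTopology F] {μ : Measure E} {ν : Measure F} [IsFiniteMeasure μ]
    [IsFiniteMeasure ν] (hμ : MemLp id 2 μ) (hν : MemLp id 2 ν) : MemLp id 2 (μ.prod ν) := by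
  have h1 : MemLp (fun p : E × F => ‖p.1‖) 2 (μ.prod ν) := (hμ.comp_fst ν).norm
  have h2 : MemLp (fun p : E × F => ‖p.2‖) 2 (μ.prod ν) := (hν.comp_snd μ).norm
  refine (h1.add h2).mono measurable_id.aestronglyMeasurable
    (Filter.Eventually.of_forall fun p => le_trans ?_ (Real.le_norm_self _))
  exact max_le (le_add_of_nonneg_right (norm_nonneg _)) (le_add_of_nonneg_left (norm_nonneg _))

lemma memLp_id_noiseDist (k n : ℕ) : MemLp id 2 (noiseDist k n) :=
  memLp_id_prod (memLp_id_axisGaussian _) (memLp_id_pi _ fun _ => memLp_id_axisGaussian _)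

lemma integrable_sq_noiseDist (k n : ℕ) :
    Integrable (fun p => (1 + ‖p‖) ^ 2) (noiseDist k n) :=
  ((memLp_const (1 : ℝ)).add (memLp_id_noiseDist k n).norm).integrable_sq

lemma norm_affineSample_le {d : ℕ} (θ : Params d) (ξ : Fin d → ℝ) :
    ‖affineSample θ ξ‖ ≤ ‖θ‖ * (1 + ‖ξ‖) := by
  calc ‖affineSample θ ξ‖ ≤ ‖θ.1‖ + ‖θ.2‖ * ‖ξ‖ :=
        (norm_add_le _ _).trans (add_le_add_right (norm_mul_le _ _) _)
    _ ≤ ‖θ‖ + ‖θ‖ * ‖ξ‖ := add_le_add (norm_fst_le θ)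
        (mul_le_mul_of_nonneg_right (norm_snd_le θ) (norm_nonneg _))
    _ = ‖θ‖ * (1 + ‖ξ‖) := by ring

lemma norm_jointSample_le {k n : ℕ} (θ : Params (k + 1) × (Fin n → Params k))
    (p : (Fin (k + 1) → ℝ) × (Fin n → Fin k → ℝ)) :
    ‖jointSample θ.1 θ.2 p‖ ≤ ‖θ‖ * (1 + ‖p‖) := by
  refine max_le ?_ ((pi_norm_le_iff_of_nonneg (by positivity)).2 fun i => ?_)
  · refine (norm_affineSample_le _ _).trans ?_
    gcongr
    · exact norm_fst_le θ
    · exact norm_fst_le p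
  · refine (norm_affineSample_le _ _).trans ?_
    gcongr
    · exact (norm_le_pi_norm θ.2 i).trans (norm_snd_le θ)
    · exact (norm_le_pi_norm p.2 i).trans (norm_snd_le p)

end Sampling

/-! ### Finiteness, continuity and convexity of expected costs. -/

section ExpectedCost

variable {k n : ℕ} {c : (Fin (k + 1) → ℝ) → (Fin n → Fin k → ℝ) → ℝ}

/-- Uniform in a ball of strategies, this is the majorant for integrability and dominated
convergence. It rests on `1 + R * (1 + ‖p‖) ≤ (1 + R) * (1 + ‖p‖)`. -/
lemma norm_comp_jointSample_le {C : ℝ} (hC : ∀ p, ‖Function.uncurry c p‖ ≤ C * (1 + ‖p‖) ^ 2)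
    {θ : Params (k + 1) × (Fin n → Params k)} {R : ℝ} (hθ : ‖θ‖ ≤ R)
    (p : (Fin (k + 1) → ℝ) × (Fin n → Fin k → ℝ)) :
    ‖Function.uncurry c (jointSample θ.1 θ.2 p)‖ ≤ C * (1 + R) ^ 2 * (1 + ‖p‖) ^ 2 := by
  have hC0 : 0 ≤ C := by simpa using (norm_nonneg _).trans (hC 0)
  have hR : 0 ≤ R := (norm_nonneg _).trans hθ
  refine (hC _).trans ?_
  rw [mul_assoc, ← mul_pow]
  have h1 : ‖jointSample θ.1 θ.2 p‖ ≤ R * (1 + ‖p‖) :=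
    (norm_jointSample_le θ p).trans (by gcongr)
  gcongr
  linarith [norm_nonneg p]

lemma integrable_comp_jointSample (hc : Continuous (Function.uncurry c)) {C : ℝ}
    (hC : ∀ p, ‖Function.uncurry c p‖ ≤ C * (1 + ‖p‖) ^ 2)
    (θl : Params (k + 1)) (θd : Fin n → Params k) :
    Integrable (fun p => Function.uncurry c (jointSample θl θd p)) (noiseDist k n) :=
  ((integrable_sq_noiseDist k n).const_mul (C * (1 + ‖(θl, θd)‖) ^ 2)).mono'
    (hc.comp (continuous_jointSample θl θd)).measurable.aestronglyMeasurable
    (Filter.Eventually.of_forall fun p =>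
      norm_comp_jointSample_le hC (θ := (θl, θd)) le_rfl p)

lemma hasFiniteExpectedCost_of_quadratic_growth (hc : Continuous (Function.uncurry c)) {C : ℝ}
    (hC : ∀ p, ‖Function.uncurry c p‖ ≤ C * (1 + ‖p‖) ^ 2)
    (θl : Params (k + 1)) (θd : Fin n → Params k) : HasFiniteExpectedCost c θl θd := by
  change Integrable (Function.uncurry c) (jointDist θl θd)
  rw [jointDist_eq_map, integrable_map_measure (hc.measurable.aestronglyMeasurable)
    (continuous_jointSample θl θd).measurable.aemeasurable]
  exact integrable_comp_jointSample hc hC θl θd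

lemma expectedCost_eq_integral_noiseDist (hc : Continuous (Function.uncurry c))
    (θl : Params (k + 1)) (θd : Fin n → Params k) :
    expectedCost c θl θd =
      ∫ p, Function.uncurry c (jointSample θl θd p) ∂(noiseDist k n) := by
  unfold expectedCost
  rw [jointDist_eq_map]
  exact integral_map (continuous_jointSample θl θd).measurable.aemeasurable
    hc.measurable.aestronglyMeasurable

/-- The expectation of a continuous cost of quadratic growth depends continuously on the
strategy profile. -/
lemma continuous_expectedCost (hc : Continuous (Function.uncurry c)) {C : ℝ}
    (hC : ∀ p, ‖Function.uncurry c p‖ ≤ C * (1 + ‖p‖) ^ 2) :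
    Continuous fun θ : Params (k + 1) × (Fin n → Params k) => expectedCost c θ.1 θ.2 := by
  simp_rw [expectedCost_eq_integral_noiseDist hc]
  refine continuous_iff_continuousAt.2 fun θ₀ => ?_
  refine continuousAt_of_dominated
    (bound := fun p => C * (1 + (‖θ₀‖ + 1)) ^ 2 * (1 + ‖p‖) ^ 2)
    (Filter.Eventually.of_forall fun θ =>
      (hc.comp (continuous_jointSample θ.1 θ.2)).measurable.aestronglyMeasurable)
    ?_ ((integrable_sq_noiseDist k n).const_mul _)
    (Filter.Eventually.of_forall fun p =>
      (hc.comp (continuous_jointSample_profile p)).continuousAt)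
  have : ∀ᶠ θ in nhds θ₀, ‖θ‖ < ‖θ₀‖ + 1 :=
    continuous_norm.continuousAt.eventually_lt_const (by linarith)
  filter_upwards [this] with θ hθ
  exact Filter.Eventually.of_forall fun p => norm_comp_jointSample_le hC hθ.le p

lemma affineSample_combo {d : ℕ} (θ θ' : Params d) (s t : ℝ) (ξ : Fin d → ℝ) :
    affineSample (s • θ + t • θ') ξ = s • affineSample θ ξ + t • affineSample θ' ξ := by
  ext j
  simp only [affineSample, Prod.fst_add, Prod.snd_add, Prod.smul_fst, Prod.smul_snd,
    Pi.add_apply, Pi.mul_apply, Pi.smul_apply, smul_eq_mul]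
  ring

lemma convexOn_expectedCost_learner (hc : Continuous (Function.uncurry c)) {C : ℝ}
    (hC : ∀ p, ‖Function.uncurry c p‖ ≤ C * (1 + ‖p‖) ^ 2)
    (hconv : ∀ X, ConvexOn ℝ Set.univ fun w => c w X) {A : Set (Params (k + 1))}
    (hA : Convex ℝ A) (θd : Fin n → Params k) :
    ConvexOn ℝ A fun θl => expectedCost c θl θd := by
  refine ⟨hA, fun θ _ θ' _ s t hs ht hst => ?_⟩
  have hint := fun θl => integrable_comp_jointSample hc hC θl θd
  simp only [expectedCost_eq_integral_noiseDist hc, smul_eq_mul]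
  rw [← integral_const_mul, ← integral_const_mul,
    ← integral_add ((hint θ).const_mul s) ((hint θ').const_mul t)]
  refine integral_mono (hint _) (((hint θ).const_mul s).add ((hint θ').const_mul t)) fun p => ?_
  simp only [jointSample, affineSample_combo, Function.uncurry_apply_pair]
  exact (hconv _).2 (Set.mem_univ _) (Set.mem_univ _) hs ht hst

lemma convexOn_expectedCost_generator (hc : Continuous (Function.uncurry c)) {C : ℝ}
    (hC : ∀ p, ‖Function.uncurry c p‖ ≤ C * (1 + ‖p‖) ^ 2)
    (hconv : ∀ w, ConvexOn ℝ Set.univ fun X => c w X) {B : Set (Fin n → Params k)}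
    (hB : Convex ℝ B) (θl : Params (k + 1)) :
    ConvexOn ℝ B fun θd => expectedCost c θl θd := by
  refine ⟨hB, fun θ _ θ' _ s t hs ht hst => ?_⟩
  have hint := fun θd => integrable_comp_jointSample hc hC θl θd
  simp only [expectedCost_eq_integral_noiseDist hc, smul_eq_mul]
  rw [← integral_const_mul, ← integral_const_mul,
    ← integral_add ((hint θ).const_mul s) ((hint θ').const_mul t)]
  refine integral_mono (hint _) (((hint θ).const_mul s).add ((hint θ').const_mul t)) fun p => ?_
  simp only [jointSample, Pi.add_apply, Pi.smul_apply, affineSample_combo,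
    Function.uncurry_apply_pair]
  exact (hconv _).2 (Set.mem_univ _) (Set.mem_univ _) hs ht hst

end ExpectedCost

end SVMGame

namespace SVMGame

/-! ### Continuity, convexity and quadratic growth of the two costs. -/

section Costs

variable {k n : ℕ}

lemma continuous_learnerCost (ρ : ℝ) (y : Fin n → ℝ) :
    Continuous (Function.uncurry (learnerCost (k := k) ρ y)) := by
  unfold Function.uncurry learnerCost sqNorm learnerLoss decision weights bias
  fun_prop

lemma continuous_generatorCost (ρ : ℝ) (xhat : Fin n → Fin k → ℝ) (y : Fin n → ℝ) :
    Continuous (Function.uncurry (generatorCost ρ xhat y)) := by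
  unfold Function.uncurry generatorCost sqNorm generatorLoss decision weights bias
  simp only [Pi.sub_apply]
  fun_prop

lemma convexOn_sqNorm {d : ℕ} : ConvexOn ℝ Set.univ (sqNorm (d := d)) := by
  refine ⟨convex_univ, fun v _ w _ s t hs ht hst => ?_⟩
  simp only [sqNorm, smul_eq_mul, Finset.mul_sum, ← Finset.sum_add_distrib]
  refine Finset.sum_le_sum fun j _ => ?_
  exact (even_two.convexOn_pow (𝕜 := ℝ)).2 (Set.mem_univ (v j)) (Set.mem_univ (w j)) hs ht hst

lemma max_zero_combo_le {a b s t : ℝ} (hs : 0 ≤ s) (ht : 0 ≤ t) :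
    max 0 (s * a + t * b) ≤ s * max 0 a + t * max 0 b :=
  max_le (add_nonneg (mul_nonneg hs (le_max_left _ _)) (mul_nonneg ht (le_max_left _ _)))
    (add_le_add (mul_le_mul_of_nonneg_left (le_max_right _ _) hs)
      (mul_le_mul_of_nonneg_left (le_max_right _ _) ht))

lemma learnerLoss_combo_le {y z z' s t : ℝ} (hs : 0 ≤ s) (ht : 0 ≤ t) (hst : s + t = 1) :
    learnerLoss (s * z + t * z') y ≤ s * learnerLoss z y + t * learnerLoss z' y := by
  refine le_trans (le_of_eq ?_) (max_zero_combo_le hs ht)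
  unfold learnerLoss
  congr 1
  linear_combination (-1 : ℝ) * hst

lemma generatorLoss_combo_le {y z z' s t : ℝ} (hs : 0 ≤ s) (ht : 0 ≤ t) (hst : s + t = 1) :
    generatorLoss (s * z + t * z') y ≤ s * generatorLoss z y + t * generatorLoss z' y := by
  refine le_trans (le_of_eq ?_) (max_zero_combo_le hs ht)
  unfold generatorLoss
  congr 1
  linear_combination (-1 : ℝ) * hst

lemma decision_combo_left (w w' : Fin (k + 1) → ℝ) (x : Fin k → ℝ) (s t : ℝ) :
    decision (s • w + t • w') x = s * decision w x + t * decision w' x := by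
  simp only [decision, weights, bias, Pi.add_apply, Pi.smul_apply, smul_eq_mul, add_mul,
    Finset.sum_add_distrib, mul_add, Finset.mul_sum, mul_assoc]
  ring

/-- Unlike in `w`, where the bias is a coordinate, the decision function is only affine in the
sample, hence the need for `s + t = 1`. -/
lemma decision_combo_right (w : Fin (k + 1) → ℝ) (x x' : Fin k → ℝ) {s t : ℝ}
    (hst : s + t = 1) :
    decision w (s • x + t • x') = s * decision w x + t * decision w x' := by
  simp only [decision, Pi.add_apply, Pi.smul_apply, smul_eq_mul, mul_add,
    Finset.sum_add_distrib, Finset.mul_sum, mul_left_comm]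
  linear_combination (-bias w) * hst

lemma convexOn_learnerCost {ρ : ℝ} (hρ : 0 ≤ ρ) (y : Fin n → ℝ) (X : Fin n → Fin k → ℝ) :
    ConvexOn ℝ Set.univ fun w => learnerCost ρ y w X := by
  refine ⟨convex_univ, fun w _ w' _ s t hs ht hst => ?_⟩
  have h1 : sqNorm (weights (s • w + t • w')) ≤
      s * sqNorm (weights w) + t * sqNorm (weights w') :=
    convexOn_sqNorm.2 (Set.mem_univ (weights w)) (Set.mem_univ (weights w')) hs ht hst
  have h2 : ∑ i, learnerLoss (decision (s • w + t • w') (X i)) (y i) ≤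
      s * ∑ i, learnerLoss (decision w (X i)) (y i) +
        t * ∑ i, learnerLoss (decision w' (X i)) (y i) := by
    rw [Finset.mul_sum, Finset.mul_sum, ← Finset.sum_add_distrib]
    refine Finset.sum_le_sum fun i _ => ?_
    rw [decision_combo_left]
    exact learnerLoss_combo_le hs ht hst
  simp only [learnerCost, smul_eq_mul]
  have h3 := mul_le_mul_of_nonneg_left h1 (div_nonneg hρ zero_le_two)
  linarith

lemma convexOn_generatorCost {ρ : ℝ} (hρ : 0 ≤ ρ) (xhat : Fin n → Fin k → ℝ) (y : Fin n → ℝ)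
    (w : Fin (k + 1) → ℝ) :
    ConvexOn ℝ Set.univ fun X => generatorCost ρ xhat y w X := by
  refine ⟨convex_univ, fun X _ X' _ s t hs ht hst => ?_⟩
  have h1 : ∑ i, sqNorm ((s • X + t • X') i - xhat i) ≤
      s * ∑ i, sqNorm (X i - xhat i) + t * ∑ i, sqNorm (X' i - xhat i) := by
    rw [Finset.mul_sum, Finset.mul_sum, ← Finset.sum_add_distrib]
    refine Finset.sum_le_sum fun i _ => ?_
    have heq : (s • X + t • X') i - xhat i = s • (X i - xhat i) + t • (X' i - xhat i) := by
      ext j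
      simp only [Pi.add_apply, Pi.smul_apply, Pi.sub_apply, smul_eq_mul]
      linear_combination (xhat i j) * hst
    rw [heq]
    exact convexOn_sqNorm.2 (Set.mem_univ _) (Set.mem_univ _) hs ht hst
  have h2 : ∑ i, generatorLoss (decision w ((s • X + t • X') i)) (y i) ≤
      s * ∑ i, generatorLoss (decision w (X i)) (y i) +
        t * ∑ i, generatorLoss (decision w (X' i)) (y i) := by
    rw [Finset.mul_sum, Finset.mul_sum, ← Finset.sum_add_distrib]
    refine Finset.sum_le_sum fun i _ => ?_
    rw [Pi.add_apply, Pi.smul_apply, Pi.smul_apply, decision_combo_right _ _ _ hst]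
    exact generatorLoss_combo_le hs ht hst
  simp only [generatorCost, smul_eq_mul]
  have h3 := mul_le_mul_of_nonneg_left h1 (div_nonneg hρ zero_le_two)
  linarith

open Asymptotics

/-- Along the filter `⊤` a big-O relation is a bound at every point, so its calculus yields the
global growth bounds. -/
lemma isBigO_one_le_norm {E : Type*} [NormedAddCommGroup E] (a : ℝ) :
    (fun _ : E => a) =O[⊤] fun p : E => 1 + ‖p‖ :=
  IsBigO.of_bound |a| (Filter.Eventually.of_forall fun p => by
    rw [Real.norm_eq_abs, Real.norm_of_nonneg (by positivity)]
    exact le_mul_of_one_le_right (abs_nonneg a) (by linarith [norm_nonneg p]))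

lemma isBigO_sq_of_isBigO {E : Type*} [NormedAddCommGroup E] {f : E → ℝ}
    (hf : f =O[⊤] fun p : E => 1 + ‖p‖) : f =O[⊤] fun p : E => (1 + ‖p‖) ^ 2 := by
  simpa [pow_two] using hf.mul (isBigO_one_le_norm (E := E) 1)

lemma isBigO_weight (j : Fin (k + 1)) :
    (fun p : (Fin (k + 1) → ℝ) × (Fin n → Fin k → ℝ) => p.1 j) =O[⊤] fun p => 1 + ‖p‖ :=
  IsBigO.of_bound 1 (Filter.Eventually.of_forall fun p => by
    rw [Real.norm_of_nonneg (by positivity : 0 ≤ 1 + ‖p‖), one_mul]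
    linarith [norm_le_pi_norm p.1 j, norm_fst_le p])

lemma isBigO_sample (i : Fin n) (j : Fin k) :
    (fun p : (Fin (k + 1) → ℝ) × (Fin n → Fin k → ℝ) => p.2 i j) =O[⊤] fun p => 1 + ‖p‖ :=
  IsBigO.of_bound 1 (Filter.Eventually.of_forall fun p => by
    rw [Real.norm_of_nonneg (by positivity : 0 ≤ 1 + ‖p‖), one_mul]
    linarith [norm_le_pi_norm (p.2 i) j, norm_le_pi_norm p.2 i, norm_snd_le p])

/-- Weights multiply samples, both of linear growth; thus the hinge terms too are quadratic, and
second moments of the joint noise suffice. -/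
lemma isBigO_decision (i : Fin n) :
    (fun p : (Fin (k + 1) → ℝ) × (Fin n → Fin k → ℝ) => decision p.1 (p.2 i))
      =O[⊤] fun p => (1 + ‖p‖) ^ 2 := by
  unfold decision weights
  refine IsBigO.add (IsBigO.fun_sum fun j _ => ?_) (isBigO_sq_of_isBigO (isBigO_weight _))
  simpa only [pow_two] using (isBigO_weight j.castSucc).mul (isBigO_sample i j)

lemma isBigO_max_zero {α : Type*} {f g : α → ℝ} {l : Filter α} (h : f =O[l] g) :
    (fun p => max 0 (f p)) =O[l] g :=
  IsBigO.trans (IsBigO.of_bound 1 (Filter.Eventually.of_forall fun p => by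
    rw [one_mul, Real.norm_of_nonneg (le_max_left _ _), Real.norm_eq_abs]
    exact max_le (abs_nonneg _) (le_abs_self _))) h

lemma exists_bound_of_isBigO {E : Type*} [NormedAddCommGroup E] {f : E → ℝ}
    (hf : f =O[⊤] fun p : E => (1 + ‖p‖) ^ 2) : ∃ C, ∀ p, ‖f p‖ ≤ C * (1 + ‖p‖) ^ 2 := by
  obtain ⟨C, hC⟩ := hf.bound
  refine ⟨C, fun p => ?_⟩
  have := Filter.eventually_top.1 hC p
  rwa [Real.norm_of_nonneg (by positivity : 0 ≤ (1 + ‖p‖) ^ 2)] at this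

lemma exists_bound_learnerCost (ρ : ℝ) (y : Fin n → ℝ) :
    ∃ C, ∀ p, ‖Function.uncurry (learnerCost (k := k) ρ y) p‖ ≤ C * (1 + ‖p‖) ^ 2 := by
  refine exists_bound_of_isBigO ?_
  unfold Function.uncurry learnerCost sqNorm learnerLoss weights
  refine IsBigO.add (IsBigO.const_mul_left (IsBigO.fun_sum fun j _ => ?_) _)
    (IsBigO.fun_sum fun i _ => isBigO_max_zero ?_)
  · exact (isBigO_weight _).pow 2
  · refine (isBigO_sq_of_isBigO (isBigO_one_le_norm 1)).sub ?_
    simpa only [mul_comm] using (isBigO_decision i).const_mul_left (y i)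

lemma exists_bound_generatorCost (ρ : ℝ) (xhat : Fin n → Fin k → ℝ) (y : Fin n → ℝ) :
    ∃ C, ∀ p, ‖Function.uncurry (generatorCost ρ xhat y) p‖ ≤ C * (1 + ‖p‖) ^ 2 := by
  refine exists_bound_of_isBigO ?_
  unfold Function.uncurry generatorCost sqNorm generatorLoss
  refine IsBigO.add (IsBigO.const_mul_left (IsBigO.fun_sum fun i _ => IsBigO.fun_sum fun j _ => ?_) _)
    (IsBigO.fun_sum fun i _ => isBigO_max_zero ?_)
  · exact ((isBigO_sample i j).sub (isBigO_one_le_norm (xhat i j))).pow 2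
  · refine (isBigO_sq_of_isBigO (isBigO_one_le_norm 1)).add ?_
    simpa only [mul_comm] using (isBigO_decision i).const_mul_left (y i)

end Costs

end SVMGame

theorem mainTheorem4 (k n : ℕ)
    (xhat : Fin n → Fin k → ℝ) (y : Fin n → ℝ) (hy : ∀ i, y i = -1 ∨ y i = 1)
    (ρl ρd : ℝ) (hρl : 0 < ρl) (hρd : 0 < ρd)
    (Bl : Set (SVMGame.Params (k + 1))) (hBl : Bl ⊆ SVMGame.gaussianParams (k + 1))
    (hBl_ne : Bl.Nonempty) (hBl_conv : Convex ℝ Bl)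
    (hBl_bdd : Bornology.IsBounded Bl) (hBl_closed : IsClosed Bl)
    (Bd : Set (SVMGame.Params k)) (hBd : Bd ⊆ SVMGame.gaussianParams k)
    (hBd_ne : Bd.Nonempty) (hBd_conv : Convex ℝ Bd)
    (hBd_bdd : Bornology.IsBounded Bd) (hBd_closed : IsClosed Bd) :
    (∀ θl ∈ SVMGame.learnerStrategies Bl, ∀ θd ∈ SVMGame.generatorStrategies n Bd,
      SVMGame.HasFiniteExpectedCost (SVMGame.learnerCost ρl y) θl θd ∧
      SVMGame.HasFiniteExpectedCost (SVMGame.generatorCost ρd xhat y) θl θd) ∧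
    ∃ (θl : SVMGame.Params (k + 1)) (θd : Fin n → SVMGame.Params k),
      SVMGame.IsNashEquilibrium
        (SVMGame.learnerStrategies Bl) (SVMGame.generatorStrategies n Bd)
        (SVMGame.expectedCost (SVMGame.learnerCost ρl y))
        (SVMGame.expectedCost (SVMGame.generatorCost ρd xhat y)) θl θd := by
  have hl := SVMGame.continuous_learnerCost (k := k) ρl y
  have hd := SVMGame.continuous_generatorCost ρd xhat y
  obtain ⟨Cl, hCl⟩ := SVMGame.exists_bound_learnerCost (k := k) ρl y
  obtain ⟨Cd, hCd⟩ := SVMGame.exists_bound_generatorCost ρd xhat y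
  refine ⟨fun θl _ θd _ => ⟨SVMGame.hasFiniteExpectedCost_of_quadratic_growth hl hCl θl θd,
    SVMGame.hasFiniteExpectedCost_of_quadratic_growth hd hCd θl θd⟩, ?_⟩
  -- Since the given sets already consist of Gaussian parameters, the strategy sets inherit their
  -- convexity and, by Heine–Borel, compactness.
  have hA : SVMGame.learnerStrategies Bl = Bl := Set.inter_eq_right.2 hBl
  have hB : SVMGame.generatorStrategies n Bd = Set.univ.pi fun _ => Bd := by
    unfold SVMGame.generatorStrategies
    rw [Set.inter_eq_right.2 hBd]
  have hBconv : Convex ℝ (Set.univ.pi fun _ : Fin n => Bd) := convex_pi fun _ _ => hBd_conv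
  rw [hA, hB]
  exact SVMGame.exists_isNashEquilibrium hBl_conv
    (Metric.isCompact_of_isClosed_isBounded hBl_closed hBl_bdd) hBl_ne hBconv
    (isCompact_univ_pi fun _ => Metric.isCompact_of_isClosed_isBounded hBd_closed hBd_bdd)
    (Set.univ_pi_nonempty_iff.2 fun _ => hBd_ne) _ _
    (SVMGame.continuous_expectedCost hl hCl) (SVMGame.continuous_expectedCost hd hCd)
    (fun θd _ => SVMGame.convexOn_expectedCost_learner hl hCl
      (SVMGame.convexOn_learnerCost hρl.le y) hBl_conv θd)
    (fun θl _ => SVMGame.convexOn_expectedCost_generator hd hCd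
      (SVMGame.convexOn_generatorCost hρd.le xhat y) hBconv θl)
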